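/- For every $\gamma\ge 0$ there is a constant $C=C(\gamma)>0$ such that the following holds for every $L>0$. Let $u=u(x,t)$, $t\ge 0$, be a solution of the (destabilized) Kuramoto–Sivashinsky equation $$u_t=-u_{xxxx}-u_{xx}+\gamma u+u u_x$$ with periodic boundary conditions on $[-L,L]$ (that is, $2L$-periodic in $x$), with initial datum $u(\cdot,0)\in L^2[-L,L]$ of mean zero, $\int_{-L}^{L}u(x,0)\,dx=0$. Here "solution" means that $u$ is classical for $t>0$ ($u,u_x,u_{xx},u_{xxx},u_{xxxx}$ exist and are continuous in $(x,t)$ for $t>0$, $u$ is differentiable in $t$, and the equation holds pointwise) and that $\|u(\cdot,t)-u(\cdot,0)\|_{L^2[-L,L]}\to 0$ as $t\to 0^+$. Then $$\limsup_{t\to\infty}\|u(\cdot,t)\|_{L^2[-L,L]}\le C L^{3/2},$$ and there is a time $T$ (depending on the solution) such that $\|u(\cdot,t)\|_{L^2[-L,L]}\le C L^{3/2}$ for all $t\ge T$. No symmetry of the initial datum is assumed. -/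

import Mathlib

open Set Filter Topology MeasureTheory
open scoped ENNReal

/-- The norm of `L²[-L, L]`, with values in `[0, ∞]`. -/
noncomputable def l2Norm (L : ℝ) (f : ℝ → ℝ) : ℝ≥0∞ :=
  eLpNorm f 2 (volume.restrict (Icc (-L) L))

/-- `u t x` is a solution, for all times `t ≥ 0`, of the (destabilized) Kuramoto-Sivashinsky
equation `u_t = -u_xxxx - u_xx + γ u + u u_x` with periodic boundary conditions on `[-L, L]` and
initial datum `u 0` in `L²[-L, L]`: it is classical for positive times, where `u`, `u_x`, ...,
`u_xxxx` exist and are jointly continuous (hence so is `u_t`, by the equation), and it attains its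
initial datum in `L²[-L, L]`. -/
structure IsKSSolution (γ L : ℝ) (u : ℝ → ℝ → ℝ) : Prop where
  /-- periodic boundary conditions -/
  periodic : ∀ t, 0 ≤ t → Function.Periodic (u t) (2 * L)
  /-- regularity in space at positive times -/
  contDiff : ∀ t, 0 < t → ContDiff ℝ 4 (u t)
  /-- joint continuity of the spatial derivatives of order at most four -/
  continuousOn : ∀ k : ℕ, k ≤ 4 →
    ContinuousOn (fun p : ℝ × ℝ => iteratedDeriv k (u p.1) p.2) (Ioi 0 ×ˢ univ)
  /-- the equation -/
  equation : ∀ t, 0 < t → ∀ x : ℝ,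
    HasDerivAt (fun s => u s x)
      (-iteratedDeriv 4 (u t) x - iteratedDeriv 2 (u t) x + γ * u t x + u t x * deriv (u t) x) t
  /-- the initial datum is square integrable -/
  memLp_initial : MemLp (u 0) 2 (volume.restrict (Icc (-L) L))
  /-- the initial datum is attained in `L²` -/
  tendsto_initial : Tendsto (fun t => l2Norm L (u t - u 0)) (𝓝[>] 0) (𝓝 0)

/-!
The proof bounds the distance in `L²[-L, L]` between the solution and the translates of a suitable
comparison function `φ`, a sawtooth of slope `-c` with a smoothed jump. Since translating `φ` and
translating `u` amount to the same, it is `v = u t (· + b)` that is compared with `φ`.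

For a fixed `b`, integration by parts shows (`IsComparison.energy_le`) that the time derivative of
`∫ (v - φ) ^ 2` is twice
`-∫ v'' ^ 2 + ∫ v' ^ 2 + γ ∫ v ^ 2 + ∫ φ'' v'' + ∫ φ'' v - γ ∫ φ v + (1 / 2) ∫ φ' v ^ 2`.
The part `-c` of `φ'` gives a damping that beats the unstable linear terms. But `φ` has to be
periodic, so `φ'` has mean zero, and near the jump `φ'` is large, of total mass `2 L c`.

The damage done there is controlled by two ideas.
* At each time `b` is chosen to minimize the distance. Then `∫ v φ' = 0`, hence `v`, which has mean
  zero, is orthogonal to the profile `bump (· / w)` of the jump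
  (`integral_mul_eq_zero_of_forall_le`). This replaces the condition `v 0 = 0` that odd solutions
  satisfy.
* `bump` has integral `2` but a negative second moment. For `f` orthogonal to `bump`, the zeroth
  and first order Taylor coefficients of `f` at `0` therefore contribute with a negative sign to
  `∫ bump * f ^ 2`, which is thus at most a constant times `∫ f'' ^ 2` (`integral_bump_mul_sq_le`).

By scaling, a jump of width `w` costs at most a constant times `L c w ^ 3 ∫ v'' ^ 2`, which is
absorbed if `w ^ 3` is a small multiple of `1 / (L c)`. With this `w` both `∫ φ'' ^ 2` and `∫ φ ^ 2`
are of order `L ^ 3` (`exists_isComparison`). If `L` is so small that `w` would exceed `L`, one takes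
`φ = 0`: then the linear part is dissipative by Poincaré's inequality.

The minimal squared distance `F` therefore satisfies `F' ≤ -F + K` with `K` of order `L ^ 3`, in the
sense of upper right Dini derivatives, as at each time the distance to a fixed translate is an upper
bound for `F` (`IsKSSolution.minTranslateDist_le_gronwallBound`). Grönwall's inequality shows that
`F` is eventually at most a constant times `L ^ 3`, and so is `∫ u ^ 2 ≤ 2 F + 2 ∫ φ ^ 2`.
-/

/-! ### Inequalities for interval integrals -/

theorem sq_intervalIntegral_le {f : ℝ → ℝ} (hf : Continuous f) {a b : ℝ} (hab : a ≤ b) :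
    (∫ x in a..b, f x) ^ 2 ≤ (b - a) * ∫ x in a..b, f x ^ 2 := by
  rcases hab.eq_or_lt with rfl | h
  · simp
  set s := (∫ x in a..b, f x) / (b - a) with hs
  have hba : 0 < b - a := sub_pos.2 h
  have h0 : 0 ≤ ∫ x in a..b, (f x - s) ^ 2 :=
    intervalIntegral.integral_nonneg hab fun x _ => sq_nonneg _
  have h1 : ∫ x in a..b, (f x - s) ^ 2
      = (∫ x in a..b, f x ^ 2) - 2 * s * (∫ x in a..b, f x) + s ^ 2 * (b - a) := by
    have : ∀ x, (f x - s) ^ 2 = f x ^ 2 - 2 * s * f x + s ^ 2 := fun x => by ring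
    simp only [this]
    rw [intervalIntegral.integral_add, intervalIntegral.integral_sub,
      intervalIntegral.integral_const_mul, intervalIntegral.integral_const, smul_eq_mul]
    · ring
    all_goals exact Continuous.intervalIntegrable (by fun_prop) _ _
  have h2 : ∫ x in a..b, f x = s * (b - a) := by rw [hs]; field_simp
  rw [h1, h2] at h0
  rw [h2]
  nlinarith

/-- Cauchy-Schwarz for the increments of a `C¹` function. -/
theorem sq_sub_le_of_hasDerivAt {g g' : ℝ → ℝ} (hg : ∀ x, HasDerivAt g (g' x) x)
    (hg' : Continuous g') {a b x y : ℝ} (hx : x ∈ Icc a b) (hy : y ∈ Icc a b) :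
    (g x - g y) ^ 2 ≤ |x - y| * ∫ z in a..b, g' z ^ 2 := by
  wlog hxy : y ≤ x generalizing x y
  · have := this hy hx (le_of_not_ge hxy)
    rw [abs_sub_comm]
    linarith [show (g x - g y) ^ 2 = (g y - g x) ^ 2 by ring]
  have h1 : ∫ z in y..x, g' z = g x - g y :=
    intervalIntegral.integral_eq_sub_of_hasDerivAt (fun z _ => hg z)
      (hg'.intervalIntegrable _ _)
  rw [← h1, abs_of_nonneg (sub_nonneg.2 hxy)]
  refine (sq_intervalIntegral_le hg' hxy).trans ?_
  refine mul_le_mul_of_nonneg_left ?_ (sub_nonneg.2 hxy)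
  exact intervalIntegral.integral_mono_interval hy.1 hxy hx.2
    (Eventually.of_forall fun z => sq_nonneg _) ((hg'.pow 2).intervalIntegrable _ _)

/-- Poincaré's inequality for functions of mean zero. -/
theorem integral_sq_le_of_integral_eq_zero {g g' : ℝ → ℝ} (hg : ∀ x, HasDerivAt g (g' x) x)
    (hg' : Continuous g') {L : ℝ} (hL : 0 < L) (h0 : ∫ x in (-L)..L, g x = 0) :
    ∫ x in (-L)..L, g x ^ 2 ≤ 4 * L ^ 2 * ∫ x in (-L)..L, g' x ^ 2 := by
  have hc : Continuous g := continuous_iff_continuousAt.2 fun x => (hg x).continuousAt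
  set E := ∫ x in (-L)..L, g' x ^ 2 with hE
  have hE0 : 0 ≤ E := intervalIntegral.integral_nonneg (by linarith) fun x _ => sq_nonneg _
  obtain ⟨z, hz, hz0⟩ : ∃ z ∈ Ioo (-L) L, g z = 0 := by
    -- Rolle's theorem for a primitive of `g`
    obtain ⟨z, hz, h⟩ := exists_hasDerivAt_eq_slope (fun x => ∫ y in (-L)..x, g y) g
      (show -L < L by linarith)
      (intervalIntegral.continuous_primitive (fun a b => hc.intervalIntegrable a b) _).continuousOn
      (fun x _ => (hc.integral_hasStrictDerivAt _ _).hasDerivAt)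
    exact ⟨z, hz, by simpa [h0] using h⟩
  have hb : ∀ x ∈ Icc (-L) L, g x ^ 2 ≤ 2 * L * E := by
    intro x hx
    have := sq_sub_le_of_hasDerivAt hg hg' hx (Ioo_subset_Icc_self hz)
    rw [hz0, sub_zero] at this
    refine this.trans (mul_le_mul_of_nonneg_right ?_ hE0)
    rw [abs_le]
    constructor <;> linarith [hx.1, hx.2, hz.1, hz.2]
  calc ∫ x in (-L)..L, g x ^ 2 ≤ ∫ x in (-L)..L, 2 * L * E :=
        intervalIntegral.integral_mono_on (by linarith) ((hc.pow 2).intervalIntegrable _ _)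
          (continuous_const.intervalIntegrable _ _) hb
    _ = 4 * L ^ 2 * E := by
        rw [intervalIntegral.integral_const, smul_eq_mul]; ring

/-! ### The profile -/

/-- An even `C¹` function supported in `[-1, 1]`, with integral `2` and second moment `-2 / 3`. The
integral makes `step` jump from `-1` to `1`; coercivity rests on the negative second moment. -/
noncomputable def bump (x : ℝ) : ℝ := 105 / 16 * max (1 - x ^ 2) 0 ^ 2 * (1 - 5 * x ^ 2)

/-- The derivative of `bump`. -/
noncomputable def bumpDeriv (x : ℝ) : ℝ :=
  105 / 16 * (2 * max (1 - x ^ 2) 0 * (-2 * x)) * (1 - 5 * x ^ 2)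
    + 105 / 16 * max (1 - x ^ 2) 0 ^ 2 * (-10 * x)

/-- The odd primitive of `bump`: it equals `1` on `[1, ∞)` and `-1` on `(-∞, -1]`. -/
noncomputable def step (x : ℝ) : ℝ := ∫ y in (0)..x, bump y

theorem continuous_bump : Continuous bump := by unfold bump; fun_prop

theorem continuous_bumpDeriv : Continuous bumpDeriv := by unfold bumpDeriv; fun_prop

theorem hasDerivAt_max_zero_sq (y : ℝ) :
    HasDerivAt (fun y : ℝ => max y 0 ^ 2) (2 * max y 0) y := by
  rcases lt_trichotomy y 0 with h | h | h
  · rw [max_eq_right h.le, mul_zero]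
    refine (hasDerivAt_const y (0 : ℝ)).congr_of_eventuallyEq ?_
    filter_upwards [Iio_mem_nhds h] with z hz
    simp [max_eq_right (le_of_lt (mem_Iio.1 hz))]
  · subst h
    rw [hasDerivAt_iff_isLittleO]
    simp only [max_self, mul_zero, smul_zero, sub_zero, ne_eq, OfNat.ofNat_ne_zero,
      not_false_eq_true, zero_pow]
    refine Asymptotics.IsBigO.trans_isLittleO (g := fun x : ℝ => x ^ 2) ?_ ?_
    · refine Asymptotics.IsBigO.of_bound 1 (Eventually.of_forall fun x => ?_)
      rcases le_total x 0 with hx | hx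
      · simp [max_eq_right hx, sq_nonneg]
      · simp [max_eq_left hx]
    · simpa using Asymptotics.isLittleO_pow_id (𝕜 := ℝ) (n := 2) (by norm_num)
  · rw [max_eq_left h.le]
    have := (hasDerivAt_id y).pow 2
    refine (this.congr_of_eventuallyEq ?_).congr_deriv (by simp)
    filter_upwards [Ioi_mem_nhds h] with z hz
    simp [max_eq_left (le_of_lt (mem_Ioi.1 hz))]

theorem hasDerivAt_bump (x : ℝ) : HasDerivAt bump (bumpDeriv x) x := by
  have h1 : HasDerivAt (fun x : ℝ => 1 - x ^ 2) (-2 * x) x := by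
    have := ((hasDerivAt_id x).pow 2).const_sub 1
    exact this.congr_deriv (by simp)
  have h2 : HasDerivAt (fun x : ℝ => 1 - 5 * x ^ 2) (-10 * x) x := by
    have := (((hasDerivAt_id x).pow 2).const_mul 5).const_sub 1
    refine this.congr_deriv ?_
    simp; ring
  have h3 := (hasDerivAt_max_zero_sq (1 - x ^ 2)).comp x h1
  exact (h3.const_mul (105 / 16)).mul h2

theorem hasDerivAt_step (x : ℝ) : HasDerivAt step (bump x) x :=
  (continuous_bump.integral_hasStrictDerivAt _ _).hasDerivAt

theorem bump_eq_zero {x : ℝ} (hx : 1 ≤ |x|) : bump x = 0 := by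
  have : 1 ≤ x ^ 2 := by rw [← sq_abs]; nlinarith
  simp [bump, max_eq_right (show 1 - x ^ 2 ≤ 0 by linarith)]

theorem bumpDeriv_eq_zero {x : ℝ} (hx : 1 ≤ |x|) : bumpDeriv x = 0 := by
  have : 1 ≤ x ^ 2 := by rw [← sq_abs]; nlinarith
  simp [bumpDeriv, max_eq_right (show 1 - x ^ 2 ≤ 0 by linarith)]

theorem bump_eq_of_abs_le {x : ℝ} (hx : |x| ≤ 1) :
    bump x = 105 / 16 * (1 - 7 * x ^ 2 + 11 * x ^ 4 - 5 * x ^ 6) := by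
  have : x ^ 2 ≤ 1 := by rw [← sq_abs]; nlinarith [abs_nonneg x]
  rw [bump, max_eq_left (by linarith)]; ring

theorem abs_bump_le (x : ℝ) : |bump x| ≤ 27 := by
  rcases le_total 1 |x| with h | h
  · rw [bump_eq_zero h]; norm_num
  · have h1 : x ^ 2 ≤ 1 := by rw [← sq_abs]; nlinarith [abs_nonneg x]
    rw [bump, max_eq_left (by linarith)]
    have h2 : (1 - x ^ 2) ^ 2 ≤ 1 := by nlinarith [sq_nonneg x]
    rw [abs_mul, abs_of_nonneg (by positivity : 0 ≤ 105 / 16 * (1 - x ^ 2) ^ 2)]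
    have h3 : |1 - 5 * x ^ 2| ≤ 4 := abs_le.2 ⟨by linarith, by nlinarith [sq_nonneg x]⟩
    nlinarith [abs_nonneg (1 - 5 * x ^ 2), sq_nonneg (1 - x ^ 2)]

theorem bumpDeriv_sq_le {x : ℝ} : bumpDeriv x ^ 2 ≤ 40000 := by
  rcases le_total 1 |x| with h | h
  · rw [bumpDeriv_eq_zero h]; norm_num
  · have h1 : x ^ 2 ≤ 1 := by rw [← sq_abs]; nlinarith [abs_nonneg x]
    have h0 := sq_nonneg x
    have h2 : (1 - x ^ 2) ^ 2 ≤ 1 := by nlinarith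
    have h3 : |14 - 30 * x ^ 2| ≤ 16 := abs_le.2 ⟨by linarith, by linarith⟩
    have h4 : (14 - 30 * x ^ 2) ^ 2 ≤ 256 := by
      rw [← sq_abs]; nlinarith [abs_nonneg (14 - 30 * x ^ 2)]
    have : bumpDeriv x ^ 2
        = (105 / 16) ^ 2 * (x ^ 2 * ((1 - x ^ 2) ^ 2 * (14 - 30 * x ^ 2) ^ 2)) := by
      rw [bumpDeriv, max_eq_left (by linarith)]; ring
    rw [this]
    have h5 : (1 - x ^ 2) ^ 2 * (14 - 30 * x ^ 2) ^ 2 ≤ 1 * 256 :=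
      mul_le_mul h2 h4 (sq_nonneg _) (by norm_num)
    have h6 : x ^ 2 * ((1 - x ^ 2) ^ 2 * (14 - 30 * x ^ 2) ^ 2) ≤ 1 * (1 * 256) :=
      mul_le_mul h1 h5 (by positivity) (by norm_num)
    linarith

theorem integral_bump_mul_quadratic (a b c : ℝ) :
    ∫ x in (-1)..1, bump x * (a + b * x + c * x ^ 2) = 2 * a - 2 / 3 * c := by
  have : ∫ x in (-1)..1, bump x * (a + b * x + c * x ^ 2) = ∫ x in (-1)..1,
      105 / 16 * (a + b * x + (c - 7 * a) * x ^ 2 - 7 * b * x ^ 3 + (11 * a - 7 * c) * x ^ 4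
        + 11 * b * x ^ 5 + (11 * c - 5 * a) * x ^ 6 - 5 * b * x ^ 7 - 5 * c * x ^ 8) := by
    refine intervalIntegral.integral_congr fun x hx => ?_
    rw [uIcc_of_le (by norm_num)] at hx
    rw [bump_eq_of_abs_le (abs_le.2 hx)]; ring
  rw [this, intervalIntegral.integral_const_mul]
  have hd : ∀ x ∈ uIcc (-1 : ℝ) 1, HasDerivAt (fun x : ℝ => a * x + b * x ^ 2 / 2
      + (c - 7 * a) * x ^ 3 / 3 - 7 * b * x ^ 4 / 4 + (11 * a - 7 * c) * x ^ 5 / 5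
        + 11 * b * x ^ 6 / 6 + (11 * c - 5 * a) * x ^ 7 / 7 - 5 * b * x ^ 8 / 8 - 5 * c * x ^ 9 / 9)
      (a + b * x + (c - 7 * a) * x ^ 2 - 7 * b * x ^ 3 + (11 * a - 7 * c) * x ^ 4
        + 11 * b * x ^ 5 + (11 * c - 5 * a) * x ^ 6 - 5 * b * x ^ 7 - 5 * c * x ^ 8) x := by
    intro x _
    have p : ∀ (k : ℝ) (n : ℕ), HasDerivAt (fun x : ℝ => k * x ^ n) (k * (n * x ^ (n - 1))) x :=
      fun k n => (hasDerivAt_pow n x).const_mul k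
    have h := ((((((((((hasDerivAt_id x).const_mul a).add ((p b 2).div_const 2)).add
      ((p (c - 7 * a) 3).div_const 3)).sub ((p (7 * b) 4).div_const 4)).add
      ((p (11 * a - 7 * c) 5).div_const 5)).add ((p (11 * b) 6).div_const 6)).add
      ((p (11 * c - 5 * a) 7).div_const 7)).sub ((p (5 * b) 8).div_const 8)).sub
      ((p (5 * c) 9).div_const 9))
    refine h.congr_deriv ?_
    norm_num
    ring
  rw [intervalIntegral.integral_eq_sub_of_hasDerivAt hd
    (Continuous.intervalIntegrable (by fun_prop) _ _)]
  ring

theorem step_eq_one {x : ℝ} (hx : 1 ≤ x) : step x = 1 := by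
  have hi := fun a b => continuous_bump.intervalIntegrable (μ := volume) a b
  have h2 : ∫ y in (-1)..1, bump y = 2 := by simpa using integral_bump_mul_quadratic 1 0 0
  have h3 : ∫ y in (-1)..0, bump y = ∫ y in (0)..1, bump y := by
    have := intervalIntegral.integral_comp_neg (a := 0) (b := 1) bump
    rw [neg_zero] at this
    rw [← this]
    exact intervalIntegral.integral_congr fun y _ => by simp [bump]
  have h4 : ∫ y in (1)..x, bump y = 0 := by
    rw [intervalIntegral.integral_congr (g := fun _ => (0 : ℝ)), intervalIntegral.integral_zero]
    intro y hy
    rw [uIcc_of_le hx] at hy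
    exact bump_eq_zero (hy.1.trans (le_abs_self y))
  rw [step, ← intervalIntegral.integral_add_adjacent_intervals (hi 0 1) (hi 1 x), h4]
  rw [← intervalIntegral.integral_add_adjacent_intervals (hi (-1) 0) (hi 0 1), h3] at h2
  linarith

theorem step_neg (x : ℝ) : step (-x) = -step x := by
  have := intervalIntegral.integral_comp_neg (a := 0) (b := x) bump
  rw [neg_zero, intervalIntegral.integral_symm] at this
  have h : ∫ y in x..0, bump (-y) = ∫ y in x..0, bump y :=
    intervalIntegral.integral_congr fun y _ => by simp [bump]
  rw [step, step, intervalIntegral.integral_symm, ← this, h, neg_neg,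
    intervalIntegral.integral_symm]

theorem abs_step_le (x : ℝ) : |step x| ≤ 27 := by
  wlog h : 0 ≤ x generalizing x
  · have := this (-x) (by linarith)
    rwa [step_neg, abs_neg] at this
  rcases le_total 1 x with h1 | h1
  · rw [step_eq_one h1]; norm_num
  · have := intervalIntegral.norm_integral_le_of_norm_le_const (a := 0) (b := x) (C := 27) (f := bump)
      (fun y _ => abs_bump_le y)
    rw [sub_zero, abs_of_nonneg h] at this
    exact this.trans (by linarith)

/-! ### Coercivity -/

/-- Write `f y = α + β y + r y`, where `r` is controlled by the second derivative. Since `bump` is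
even and `∫ bump * f = 0`, the quadratic form is `-2 α² - (2/3) β²` plus terms that contain `r`: the
negative second moment of `bump` takes care of `β`, the orthogonality takes care of `α`. -/
theorem integral_bump_mul_sq_le {f f₁ f₂ : ℝ → ℝ} (hf : ∀ x, HasDerivAt f (f₁ x) x)
    (hf₁ : ∀ x, HasDerivAt f₁ (f₂ x) x) (hf₂ : Continuous f₂)
    (h0 : ∫ x in (-1)..1, bump x * f x = 0) :
    ∫ x in (-1)..1, bump x * f x ^ 2 ≤ 5000 * ∫ x in (-1)..1, f₂ x ^ 2 := by
  have cf : Continuous f := continuous_iff_continuousAt.2 fun x => (hf x).continuousAt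
  have cb := continuous_bump
  set E := ∫ x in (-1)..1, f₂ x ^ 2 with hE
  have hE0 : 0 ≤ E := intervalIntegral.integral_nonneg (by norm_num) fun x _ => sq_nonneg _
  set e := √E with he
  have hee : e ^ 2 = E := Real.sq_sqrt hE0
  have he0 : 0 ≤ e := Real.sqrt_nonneg _
  set α := f 0
  set β := f₁ 0
  set r : ℝ → ℝ := fun x => f x - α - β * x with hr
  have cr : Continuous r := by fun_prop
  have hrd : ∀ x, HasDerivAt r (f₁ x - β) x := fun x => by
    have := ((hf x).sub_const α).sub ((hasDerivAt_id x).const_mul β)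
    exact this.congr_deriv (by simp)
  have hf₁b : ∀ x ∈ Icc (-1 : ℝ) 1, ‖f₁ x - β‖ ≤ e := by
    intro x hx
    have := sq_sub_le_of_hasDerivAt hf₁ hf₂ hx (y := 0) (by norm_num)
    rw [sub_zero] at this
    refine abs_le_of_sq_le_sq ?_ he0
    rw [hee]
    exact this.trans (mul_le_of_le_one_left hE0 (abs_le.2 hx))
  have hrb : ∀ x ∈ Icc (-1 : ℝ) 1, |r x| ≤ e := by
    intro x hx
    have := (convex_Icc (-1 : ℝ) 1).norm_image_sub_le_of_norm_hasDerivWithin_le (x := 0) (y := x)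
      (fun y _ => (hrd y).hasDerivWithinAt) hf₁b (by norm_num) hx
    have hr0 : r 0 = 0 := by simp [hr, α]
    rw [hr0, sub_zero, sub_zero] at this
    exact this.trans (mul_le_of_le_one_right he0 (abs_le.2 hx))
  have hI : (∫ x in (-1)..1, bump x * r x) = -2 * α := by
    have h1 : ∀ x, bump x * r x = bump x * f x - bump x * (α + β * x + 0 * x ^ 2) := fun x => by
      simp only [hr]; ring
    simp only [h1]
    rw [intervalIntegral.integral_sub, h0, integral_bump_mul_quadratic]
    · ring
    all_goals exact Continuous.intervalIntegrable (by fun_prop) _ _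
  have hJ : |∫ x in (-1)..1, bump x * (x * r x)| ≤ 54 * e := by
    have := intervalIntegral.norm_integral_le_of_norm_le_const (a := -1) (b := 1) (C := 27 * e)
      (f := fun x => bump x * (x * r x)) (fun x hx => by
        rw [uIoc_of_le (by norm_num)] at hx
        have hx' : x ∈ Icc (-1 : ℝ) 1 := Ioc_subset_Icc_self hx
        rw [Real.norm_eq_abs, abs_mul, abs_mul]
        refine mul_le_mul (abs_bump_le x) ?_ (by positivity) (by norm_num)
        exact (mul_le_of_le_one_left (abs_nonneg _) (abs_le.2 hx')).trans (hrb x hx'))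
    rw [Real.norm_eq_abs] at this
    norm_num at this
    linarith
  have hR : |∫ x in (-1)..1, bump x * r x ^ 2| ≤ 54 * E := by
    have := intervalIntegral.norm_integral_le_of_norm_le_const (a := -1) (b := 1) (C := 27 * E)
      (f := fun x => bump x * r x ^ 2) (fun x hx => by
        rw [uIoc_of_le (by norm_num)] at hx
        have hx' : x ∈ Icc (-1 : ℝ) 1 := Ioc_subset_Icc_self hx
        rw [Real.norm_eq_abs, abs_mul, abs_pow, ← hee]
        exact mul_le_mul (abs_bump_le x) (pow_le_pow_left₀ (abs_nonneg _) (hrb x hx') 2)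
          (by positivity) (by norm_num))
    rw [Real.norm_eq_abs] at this
    norm_num at this
    linarith
  have hmain : ∫ x in (-1)..1, bump x * f x ^ 2 = -2 * α ^ 2 - 2 / 3 * β ^ 2
      + 2 * β * (∫ x in (-1)..1, bump x * (x * r x)) + ∫ x in (-1)..1, bump x * r x ^ 2 := by
    have h1 : ∀ x, bump x * f x ^ 2 = bump x * (α ^ 2 + 2 * α * β * x + β ^ 2 * x ^ 2)
        + 2 * α * (bump x * r x) + 2 * β * (bump x * (x * r x)) + bump x * r x ^ 2 := fun x => by
      simp only [hr]; ring
    simp only [h1]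
    rw [intervalIntegral.integral_add, intervalIntegral.integral_add,
      intervalIntegral.integral_add, intervalIntegral.integral_const_mul,
      intervalIntegral.integral_const_mul, integral_bump_mul_quadratic, hI]
    · ring
    all_goals exact Continuous.intervalIntegrable (by fun_prop) _ _
  rw [hmain]
  set J := ∫ x in (-1)..1, bump x * (x * r x)
  have hJ2 : J ^ 2 ≤ (54 * e) ^ 2 := by
    rw [← sq_abs]; exact pow_le_pow_left₀ (abs_nonneg _) hJ 2
  have := le_abs_self (∫ x in (-1)..1, bump x * r x ^ 2)
  nlinarith [sq_nonneg (β - 3 / 2 * J), sq_nonneg α]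

/-- The rescaled form of `integral_bump_mul_sq_le` on an interval that contains the support of
`bump (· / w)`. -/
theorem integral_bump_div_mul_sq_le {v v₁ v₂ : ℝ → ℝ} (hv : ∀ x, HasDerivAt v (v₁ x) x)
    (hv₁ : ∀ x, HasDerivAt v₁ (v₂ x) x) (hv₂ : Continuous v₂) {w L : ℝ} (hw : 0 < w)
    (hwL : w ≤ L) (h0 : ∫ x in (-L)..L, bump (x / w) * v x = 0) :
    ∫ x in (-L)..L, bump (x / w) * v x ^ 2 ≤ 5000 * w ^ 4 * ∫ x in (-L)..L, v₂ x ^ 2 := by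
  have cv : Continuous v := continuous_iff_continuousAt.2 fun x => (hv x).continuousAt
  have cb := continuous_bump
  have key : ∀ g : ℝ → ℝ, Continuous g →
      ∫ x in (-L)..L, bump (x / w) * g x = w * ∫ y in (-1)..1, bump y * g (w * y) := by
    intro g hg
    have hi : ∀ a b, IntervalIntegrable (fun x => bump (x / w) * g x) volume a b := fun a b =>
      Continuous.intervalIntegrable (by fun_prop) _ _
    have h1 : ∫ x in (-L)..(-w), bump (x / w) * g x = 0 := by
      rw [intervalIntegral.integral_congr (g := fun _ => (0 : ℝ)), intervalIntegral.integral_zero]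
      intro y hy
      rw [uIcc_of_le (by linarith)] at hy
      have : bump (y / w) = 0 := bump_eq_zero (by
        rw [abs_div, abs_of_pos hw, le_div_iff₀ hw, one_mul]
        exact (le_neg_of_le_neg hy.2).trans (neg_le_abs y))
      simp [this]
    have h2 : ∫ x in w..L, bump (x / w) * g x = 0 := by
      rw [intervalIntegral.integral_congr (g := fun _ => (0 : ℝ)), intervalIntegral.integral_zero]
      intro y hy
      rw [uIcc_of_le hwL] at hy
      have : bump (y / w) = 0 := bump_eq_zero (by
        rw [abs_div, abs_of_pos hw, le_div_iff₀ hw, one_mul]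
        exact hy.1.trans (le_abs_self y))
      simp [this]
    have h3 := intervalIntegral.integral_comp_mul_left (a := -1) (b := 1)
      (fun x => bump (x / w) * g x) hw.ne'
    rw [mul_neg, mul_one, smul_eq_mul] at h3
    rw [← intervalIntegral.integral_add_adjacent_intervals (hi (-L) (-w)) (hi (-w) L),
      ← intervalIntegral.integral_add_adjacent_intervals (hi (-w) w) (hi w L), h1, h2, zero_add,
      add_zero, ← mul_inv_cancel_left₀ hw.ne' (∫ x in (-w)..w, bump (x / w) * g x), ← h3]
    congr 1
    refine intervalIntegral.integral_congr fun y _ => ?_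
    simp [mul_div_cancel_left₀ y hw.ne']
  have hd : ∀ x, HasDerivAt (fun y => w * y) w x := fun x => by
    simpa using (hasDerivAt_id x).const_mul w
  have h1 := integral_bump_mul_sq_le (f := fun y => v (w * y)) (f₁ := fun y => w * v₁ (w * y))
    (f₂ := fun y => w ^ 2 * v₂ (w * y))
    (fun x => ((hv (w * x)).comp x (hd x)).congr_deriv (by ring))
    (fun x => (((hv₁ (w * x)).comp x (hd x)).const_mul w).congr_deriv (by ring)) (by fun_prop)
    (by
      rw [key v cv] at h0
      exact (mul_eq_zero.1 h0).resolve_left hw.ne')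
  rw [key (fun x => v x ^ 2) (by fun_prop)]
  have h2 : ∫ y in (-1)..1, (w ^ 2 * v₂ (w * y)) ^ 2 = w ^ 3 * ∫ x in (-w)..w, v₂ x ^ 2 := by
    have h3 := intervalIntegral.integral_comp_mul_left (a := -1) (b := 1)
      (fun x => v₂ x ^ 2) hw.ne'
    rw [mul_neg, mul_one, smul_eq_mul] at h3
    simp only [mul_pow]
    rw [intervalIntegral.integral_const_mul, h3]
    field_simp
  have h4 : ∫ x in (-w)..w, v₂ x ^ 2 ≤ ∫ x in (-L)..L, v₂ x ^ 2 :=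
    intervalIntegral.integral_mono_interval (by linarith) (by linarith) hwL
      (Eventually.of_forall fun z => sq_nonneg _) ((hv₂.pow 2).intervalIntegrable _ _)
  rw [h2] at h1
  calc w * ∫ y in (-1)..1, bump y * v (w * y) ^ 2
      ≤ w * (5000 * (w ^ 3 * ∫ x in (-w)..w, v₂ x ^ 2)) := mul_le_mul_of_nonneg_left h1 hw.le
    _ = 5000 * w ^ 4 * ∫ x in (-w)..w, v₂ x ^ 2 := by ring
    _ ≤ _ := mul_le_mul_of_nonneg_left h4 (by positivity)

/-! ### The comparison function -/

/-- Young's inequality with a parameter. -/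
theorem intervalIntegral_mul_le {f g : ℝ → ℝ} (hf : Continuous f) (hg : Continuous g) {L : ℝ}
    (hL : 0 < L) {a : ℝ} (ha : 0 < a) :
    ∫ x in (-L)..L, f x * g x
      ≤ a * (∫ x in (-L)..L, f x ^ 2) + 1 / (4 * a) * ∫ x in (-L)..L, g x ^ 2 := by
  rw [← intervalIntegral.integral_const_mul, ← intervalIntegral.integral_const_mul,
    ← intervalIntegral.integral_add]
  · refine intervalIntegral.integral_mono (by linarith) ?_ ?_ fun x => ?_
    · exact Continuous.intervalIntegrable (by fun_prop) _ _
    · exact Continuous.intervalIntegrable (by fun_prop) _ _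
    · have : a * f x ^ 2 + 1 / (4 * a) * g x ^ 2 - f x * g x
          = 1 / (4 * a) * (2 * a * f x - g x) ^ 2 := by field_simp; ring
      have h : 0 ≤ 1 / (4 * a) * (2 * a * f x - g x) ^ 2 := by positivity
      simp only
      linarith
  all_goals exact Continuous.intervalIntegrable (by fun_prop) _ _

/-- `φ`, with derivatives `φ₁` and `φ₂`, is a function whose distance to a solution is dissipated up
to the constant `K`: if `v` is a translate of the solution at some time that satisfies the
optimality condition `∫ v φ₁ = 0`, then the left-hand side of `dissipation` is the time derivative
of `∫ (v - φ) ^ 2`. -/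
structure IsComparison (γ L K : ℝ) (φ φ₁ φ₂ : ℝ → ℝ) : Prop where
  hasDerivAt : ∀ x, HasDerivAt φ (φ₁ x) x
  hasDerivAt_one : ∀ x, HasDerivAt φ₁ (φ₂ x) x
  continuous_two : Continuous φ₂
  endpoints : φ L = φ (-L)
  endpoints_one : φ₁ L = φ₁ (-L)
  dissipation : ∀ v v₁ v₂ : ℝ → ℝ, (∀ x, HasDerivAt v (v₁ x) x) → (∀ x, HasDerivAt v₁ (v₂ x) x) →
    Continuous v₂ → v L = v (-L) → v₁ L = v₁ (-L) →
    (∫ x in (-L)..L, v x) = 0 → (∫ x in (-L)..L, v x * φ₁ x) = 0 →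
    2 * (-(∫ x in (-L)..L, v₂ x ^ 2) + (∫ x in (-L)..L, v₁ x ^ 2)
      + γ * (∫ x in (-L)..L, v x ^ 2) + (∫ x in (-L)..L, φ₂ x * v₂ x)
      + (∫ x in (-L)..L, φ₂ x * v x) - γ * (∫ x in (-L)..L, φ x * v x)
      + 1 / 2 * ∫ x in (-L)..L, φ₁ x * v x ^ 2) ≤ -(∫ x in (-L)..L, (v x - φ x) ^ 2) + K

/-- On a short interval the linear part is dissipative on functions of mean zero, by Poincaré's
inequality. -/
theorem isComparison_zero {γ L : ℝ} (hγ : 0 ≤ γ) (hL : 0 < L)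
    (hs : 10000 * (5 + 3 * γ) * L ^ 4 ≤ 1) : IsComparison γ L 0 0 0 0 where
  hasDerivAt x := hasDerivAt_const x 0
  hasDerivAt_one x := hasDerivAt_const x 0
  continuous_two := continuous_const
  endpoints := rfl
  endpoints_one := rfl
  dissipation v v₁ v₂ hv hv₁ hv₂ he he₁ h0 _ := by
    have cv₁ : Continuous v₁ := continuous_iff_continuousAt.2 fun x => (hv₁ x).continuousAt
    have hV := integral_sq_le_of_integral_eq_zero hv cv₁ hL h0
    have hV₁ := integral_sq_le_of_integral_eq_zero hv₁ hv₂ hL (by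
      rw [intervalIntegral.integral_eq_sub_of_hasDerivAt (fun x _ => hv x)
        (cv₁.intervalIntegrable _ _), he, sub_self])
    simp only [Pi.zero_apply, zero_mul, sub_zero, intervalIntegral.integral_zero]
    set A := ∫ x in (-L)..L, v₂ x ^ 2
    set B := ∫ x in (-L)..L, v₁ x ^ 2
    set V := ∫ x in (-L)..L, v x ^ 2
    have hA : 0 ≤ A := intervalIntegral.integral_nonneg (by linarith) fun x _ => sq_nonneg _
    have hL2 : 4 * L ^ 2 ≤ 1 / 2 := by
      have : (L ^ 2) ^ 2 ≤ (1 / 8) ^ 2 := by nlinarith [mul_nonneg hγ (pow_nonneg hL.le 4)]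
      linarith [abs_le_of_sq_le_sq' this (by norm_num)]
    have hL4 : 16 * L ^ 4 * (γ + 1 / 2) ≤ 1 / 2 := by
      nlinarith [mul_nonneg hγ (pow_nonneg hL.le 4), pow_nonneg hL.le 4]
    have h1 : V ≤ 16 * L ^ 4 * A := by
      calc V ≤ 4 * L ^ 2 * B := hV
        _ ≤ 4 * L ^ 2 * (4 * L ^ 2 * A) := mul_le_mul_of_nonneg_left hV₁ (by positivity)
        _ = _ := by ring
    have h2 : (γ + 1 / 2) * V ≤ 1 / 2 * A := by
      calc (γ + 1 / 2) * V ≤ (γ + 1 / 2) * (16 * L ^ 4 * A) :=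
            mul_le_mul_of_nonneg_left h1 (by positivity)
        _ = 16 * L ^ 4 * (γ + 1 / 2) * A := by ring
        _ ≤ _ := mul_le_mul_of_nonneg_right hL4 hA
    have h3 : B ≤ 1 / 2 * A := hV₁.trans (mul_le_mul_of_nonneg_right hL2 hA)
    linarith

theorem integral_bumpDeriv_div_sq_le {w L : ℝ} (hw : 0 < w) (hwL : w ≤ L) :
    ∫ x in (-L)..L, bumpDeriv (x / w) ^ 2 ≤ 80000 * w := by
  have cb := continuous_bumpDeriv
  have hi : ∀ a b, IntervalIntegrable (fun x => bumpDeriv (x / w) ^ 2) volume a b := fun a b =>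
    Continuous.intervalIntegrable (by fun_prop) _ _
  have h0 : ∀ y, w ≤ |y| → bumpDeriv (y / w) ^ 2 = 0 := fun y hy => by
    rw [bumpDeriv_eq_zero, zero_pow two_ne_zero]
    rwa [abs_div, abs_of_pos hw, le_div_iff₀ hw, one_mul]
  have h1 : ∫ x in (-L)..(-w), bumpDeriv (x / w) ^ 2 = 0 := by
    rw [intervalIntegral.integral_congr (g := fun _ => (0 : ℝ)), intervalIntegral.integral_zero]
    intro y hy
    rw [uIcc_of_le (by linarith)] at hy
    exact h0 y ((le_neg_of_le_neg hy.2).trans (neg_le_abs y))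
  have h2 : ∫ x in w..L, bumpDeriv (x / w) ^ 2 = 0 := by
    rw [intervalIntegral.integral_congr (g := fun _ => (0 : ℝ)), intervalIntegral.integral_zero]
    intro y hy
    rw [uIcc_of_le hwL] at hy
    exact h0 y (hy.1.trans (le_abs_self y))
  rw [← intervalIntegral.integral_add_adjacent_intervals (hi (-L) (-w)) (hi (-w) L),
    ← intervalIntegral.integral_add_adjacent_intervals (hi (-w) w) (hi w L), h1, h2, zero_add,
    add_zero]
  calc ∫ x in (-w)..w, bumpDeriv (x / w) ^ 2 ≤ ∫ x in (-w)..w, (40000 : ℝ) :=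
        intervalIntegral.integral_mono (by linarith) (hi _ _)
          (continuous_const.intervalIntegrable _ _) fun x => bumpDeriv_sq_le
    _ = 80000 * w := by rw [intervalIntegral.integral_const, smul_eq_mul]; ring

/-- The comparison function on a long interval is a sawtooth of slope `-c` whose jump is smoothed
out at the scale `w`. -/
theorem isComparison_sawtooth {γ L w c : ℝ} (hγ : 0 ≤ γ) (hc : c = 5 + 3 * γ) (hw : 0 < w)
    (hwL : w ≤ L) (hw3 : 10000 * (L * c) * w ^ 3 = 1) :
    IsComparison γ L (3 * (∫ x in (-L)..L, (L * c / w ^ 2 * bumpDeriv (x / w)) ^ 2)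
        + (γ + 2) * ∫ x in (-L)..L, (-c * x + L * c * step (x / w)) ^ 2)
      (fun x => -c * x + L * c * step (x / w)) (fun x => -c + L * c / w * bump (x / w))
      (fun x => L * c / w ^ 2 * bumpDeriv (x / w)) := by
  have hL : 0 < L := hw.trans_le hwL
  have hc0 : 0 < c := by rw [hc]; positivity
  have cb := continuous_bump
  have cd := continuous_bumpDeriv
  have hd : ∀ x, HasDerivAt (fun y => y / w) (1 / w) x := fun x => (hasDerivAt_id x).div_const w
  have h1L : 1 ≤ L / w := (one_le_div hw).2 hwL
  have hφ : ∀ x, HasDerivAt (fun x => -c * x + L * c * step (x / w))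
      (-c + L * c / w * bump (x / w)) x := fun x => by
    refine (((hasDerivAt_id x).const_mul (-c)).add
      (((hasDerivAt_step (x / w)).comp x (hd x)).const_mul (L * c))).congr_deriv ?_
    field_simp
  have hφ₁ : ∀ x, HasDerivAt (fun x => -c + L * c / w * bump (x / w))
      (L * c / w ^ 2 * bumpDeriv (x / w)) x := fun x => by
    refine ((((hasDerivAt_bump (x / w)).comp x (hd x)).const_mul (L * c / w)).const_add
      (-c)).congr_deriv ?_
    field_simp
  refine ⟨hφ, hφ₁, by fun_prop, ?_, ?_, ?_⟩
  · rw [neg_div, step_neg, step_eq_one h1L]; ring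
  · simp [bump, neg_div]
  intro v v₁ v₂ hv hv₁ hv₂ he he₁ h0 horth
  have cv : Continuous v := continuous_iff_continuousAt.2 fun x => (hv x).continuousAt
  have cv₁ : Continuous v₁ := continuous_iff_continuousAt.2 fun x => (hv₁ x).continuousAt
  have cφ := continuous_iff_continuousAt.2 fun x => (hφ x).continuousAt
  have cφ₂ : Continuous (fun x => L * c / w ^ 2 * bumpDeriv (x / w)) := by fun_prop
  -- As `v` has mean zero, the constant part of `φ₁` drops out of the optimality condition.
  have hb0 : ∫ x in (-L)..L, bump (x / w) * v x = 0 := by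
    have h : ∀ x, v x * (-c + L * c / w * bump (x / w))
        = -c * v x + L * c / w * (bump (x / w) * v x) := fun x => by ring
    simp only [h] at horth
    rw [intervalIntegral.integral_add, intervalIntegral.integral_const_mul,
      intervalIntegral.integral_const_mul, h0, mul_zero, zero_add] at horth
    · exact (mul_eq_zero.1 horth).resolve_left (by positivity)
    all_goals exact Continuous.intervalIntegrable (by fun_prop) _ _
  have hbump := integral_bump_div_mul_sq_le hv hv₁ hv₂ hw hwL hb0
  have hφ₁v : ∫ x in (-L)..L, (-c + L * c / w * bump (x / w)) * v x ^ 2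
      = -c * (∫ x in (-L)..L, v x ^ 2) + L * c / w * ∫ x in (-L)..L, bump (x / w) * v x ^ 2 := by
    have h : ∀ x, (-c + L * c / w * bump (x / w)) * v x ^ 2
        = -c * v x ^ 2 + L * c / w * (bump (x / w) * v x ^ 2) := fun x => by ring
    simp only [h]
    rw [intervalIntegral.integral_add, intervalIntegral.integral_const_mul,
      intervalIntegral.integral_const_mul]
    all_goals exact Continuous.intervalIntegrable (by fun_prop) _ _
  have hv₁v : ∫ x in (-L)..L, v₁ x ^ 2 = ∫ x in (-L)..L, (-v x) * v₂ x := by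
    have := intervalIntegral.integral_mul_deriv_eq_deriv_mul (a := -L) (b := L)
      (fun x _ => hv x) (fun x _ => hv₁ x) (cv₁.intervalIntegrable _ _)
      (hv₂.intervalIntegrable _ _)
    rw [he, he₁, sub_self, zero_sub] at this
    simp only [neg_mul, intervalIntegral.integral_neg]
    rw [this, neg_neg]
    simp only [sq]
  have y1 := intervalIntegral_mul_le (f := fun x => -v x) cv.neg hv₂ hL one_pos
  have y2 := intervalIntegral_mul_le cφ₂ hv₂ hL one_pos
  have y3 := intervalIntegral_mul_le cφ₂ cv hL (a := 1 / 2) (by norm_num)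
  have y4 := intervalIntegral_mul_le cφ.neg cv hL (a := 1 / 2) (by norm_num)
  have y5 : ∫ x in (-L)..L, (v x - (-c * x + L * c * step (x / w))) ^ 2
      ≤ 2 * (∫ x in (-L)..L, v x ^ 2)
        + 2 * ∫ x in (-L)..L, (-c * x + L * c * step (x / w)) ^ 2 := by
    rw [← intervalIntegral.integral_const_mul, ← intervalIntegral.integral_const_mul,
      ← intervalIntegral.integral_add]
    · refine intervalIntegral.integral_mono (by linarith) ?_ ?_ fun x => ?_
      · exact Continuous.intervalIntegrable (by fun_prop) _ _
      · exact Continuous.intervalIntegrable (by fun_prop) _ _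
      · nlinarith [sq_nonneg (v x + (-c * x + L * c * step (x / w)))]
    all_goals exact Continuous.intervalIntegrable (by fun_prop) _ _
  rw [hφ₁v, hv₁v]
  simp only [Pi.neg_apply, neg_mul (_ + _), intervalIntegral.integral_neg, neg_sq] at y1 y4
  simp only [neg_mul, intervalIntegral.integral_neg] at y1 y4 ⊢
  simp only [neg_mul] at y5 y4 y2 y3
  set A := ∫ x in (-L)..L, v₂ x ^ 2
  set V := ∫ x in (-L)..L, v x ^ 2
  set Φ := ∫ x in (-L)..L, (-(c * x) + L * c * step (x / w)) ^ 2
  set X := ∫ x in (-L)..L, bump (x / w) * v x ^ 2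
  have hX : L * c / w * X ≤ 1 / 2 * A := by
    calc L * c / w * X ≤ L * c / w * (5000 * w ^ 4 * A) :=
          mul_le_mul_of_nonneg_left hbump (by positivity)
      _ = 1 / 2 * (10000 * (L * c) * w ^ 3) * A := by field_simp; ring
      _ = 1 / 2 * A := by rw [hw3, mul_one]
  have hA : 0 ≤ A := intervalIntegral.integral_nonneg (by linarith) fun x _ => sq_nonneg _
  have y4' := mul_le_mul_of_nonneg_left y4 hγ
  have hcV : c * V = 5 * V + 3 * (γ * V) := by rw [hc]; ring
  linarith

theorem exists_isComparison {γ : ℝ} (hγ : 0 ≤ γ) :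
    ∃ C : ℝ, 0 < C ∧ ∀ L : ℝ, 0 < L → ∃ (K : ℝ) (φ φ₁ φ₂ : ℝ → ℝ), IsComparison γ L K φ φ₁ φ₂ ∧
      K + (∫ x in (-L)..L, φ x ^ 2) ≤ C * L ^ 3 := by
  set c := 5 + 3 * γ with hc
  have hc0 : 0 < c := by positivity
  refine ⟨3 * (800000000 * c ^ 3) + (γ + 3) * (1568 * c ^ 2), by positivity, fun L hL => ?_⟩
  rcases le_total (10000 * c * L ^ 4) 1 with h | h
  · refine ⟨0, 0, 0, 0, isComparison_zero hγ hL h, ?_⟩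
    simp only [Pi.zero_apply, ne_eq, OfNat.ofNat_ne_zero, not_false_eq_true, zero_pow,
      intervalIntegral.integral_zero, add_zero]
    positivity
  -- The scale `w ∼ (L c) ^ (-1 / 3)` is critical: it is the largest at which the smoothed jump of
  -- height `2 L c` is a small perturbation of `∂ₓ⁴`, and it makes `∫ φ₂ ^ 2 ∼ (L c) ^ 2 / w ^ 3` of
  -- order `L ^ 3`.
  obtain ⟨w, hw, hw3⟩ : ∃ w : ℝ, 0 < w ∧ 10000 * (L * c) * w ^ 3 = 1 := by
    refine ⟨(1 / (10000 * (L * c))) ^ (1 / 3 : ℝ), by positivity, ?_⟩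
    rw [← Real.rpow_natCast, ← Real.rpow_mul (by positivity)]
    norm_num
    field_simp
  have hwL : w ≤ L := by
    refine le_of_pow_le_pow_left₀ three_ne_zero hL.le ?_
    refine le_of_mul_le_mul_left ?_ (show 0 < 10000 * (L * c) by positivity)
    rw [hw3]
    linarith [show 10000 * (L * c) * L ^ 3 = 10000 * c * L ^ 4 by ring]
  refine ⟨_, _, _, _, isComparison_sawtooth hγ hc hw hwL hw3, ?_⟩
  have h1 : ∫ x in (-L)..L, (L * c / w ^ 2 * bumpDeriv (x / w)) ^ 2
      ≤ 800000000 * c ^ 3 * L ^ 3 := by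
    simp only [mul_pow (L * c / w ^ 2)]
    rw [intervalIntegral.integral_const_mul]
    calc (L * c / w ^ 2) ^ 2 * ∫ x in (-L)..L, bumpDeriv (x / w) ^ 2
        ≤ (L * c / w ^ 2) ^ 2 * (80000 * w) :=
          mul_le_mul_of_nonneg_left (integral_bumpDeriv_div_sq_le hw hwL) (by positivity)
      _ = 80000 * (L * c) ^ 2 * (10000 * (L * c) * w ^ 3) / w ^ 3 := by rw [hw3]; field_simp
      _ = _ := by field_simp; ring
  have h2 : ∫ x in (-L)..L, (-c * x + L * c * step (x / w)) ^ 2 ≤ 1568 * c ^ 2 * L ^ 3 := by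
    have : ∀ x ∈ uIoc (-L) L, ‖(-c * x + L * c * step (x / w)) ^ 2‖ ≤ (28 * c * L) ^ 2 := by
      intro x hx
      rw [uIoc_of_le (by linarith)] at hx
      rw [norm_pow, Real.norm_eq_abs]
      refine pow_le_pow_left₀ (abs_nonneg _) ?_ 2
      have h3 : |x| ≤ L := abs_le.2 ⟨hx.1.le, hx.2⟩
      calc |-c * x + L * c * step (x / w)| ≤ |-c * x| + |L * c * step (x / w)| := abs_add_le _ _
        _ = c * |x| + L * c * |step (x / w)| := by
            rw [abs_mul, abs_mul, abs_neg, abs_of_pos hc0, abs_of_pos (mul_pos hL hc0)]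
        _ ≤ c * L + L * c * 27 := by gcongr; exact abs_step_le _
        _ = 28 * c * L := by ring
    have := intervalIntegral.norm_integral_le_of_norm_le_const this
    rw [abs_of_pos (by linarith)] at this
    refine (le_abs_self _).trans (this.trans_eq ?_)
    ring
  have h3 := mul_le_mul_of_nonneg_left h2 (show 0 ≤ γ + 3 by positivity)
  linarith

/-! ### Calculus for integrals with parameters and periodic functions -/

theorem hasDerivAt_intervalIntegral_of_continuousOn {U : Set ℝ} (hU : IsOpen U)
    {F F' : ℝ → ℝ → ℝ} (hF : ∀ t ∈ U, Continuous (F t))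
    (hF' : ContinuousOn (Function.uncurry F') (U ×ˢ univ))
    (hd : ∀ t ∈ U, ∀ x, HasDerivAt (fun s => F s x) (F' t x) t) {t : ℝ} (ht : t ∈ U) (a b : ℝ) :
    HasDerivAt (fun s => ∫ x in a..b, F s x) (∫ x in a..b, F' t x) t := by
  obtain ⟨ε, hε, hball⟩ := Metric.nhds_basis_closedBall.mem_iff.1 (hU.mem_nhds ht)
  obtain ⟨M, hM⟩ := ((isCompact_closedBall t ε).prod (isCompact_uIcc (a := a) (b := b))
    ).exists_bound_of_continuousOn (hF'.mono (prod_mono hball (subset_univ _)))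
  have hF't : Continuous (F' t) := by
    rw [← continuousOn_univ]
    exact hF'.comp (f := fun x => (t, x)) (by fun_prop) fun x _ => ⟨ht, mem_univ _⟩
  refine (intervalIntegral.hasDerivAt_integral_of_dominated_loc_of_deriv_le
    (Metric.closedBall_mem_nhds t hε) (bound := fun _ => M) ?_
    ((hF t ht).intervalIntegrable _ _) hF't.aestronglyMeasurable ?_
    (continuous_const.intervalIntegrable _ _) ?_).2
  · filter_upwards [hU.mem_nhds ht] with s hs
    exact (hF s hs).aestronglyMeasurable
  · exact Eventually.of_forall fun x hx s hs => hM (s, x) ⟨hs, uIoc_subset_uIcc hx⟩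
  · exact Eventually.of_forall fun x _ s hs => hd s (hball hs) x

/-- Integration by parts without boundary terms. -/
theorem integral_mul_deriv_eq_neg {f f' g g' : ℝ → ℝ} (hf : ∀ x, HasDerivAt f (f' x) x)
    (hg : ∀ x, HasDerivAt g (g' x) x) (hf' : Continuous f') (hg' : Continuous g') {L : ℝ}
    (hfL : f L = f (-L)) (hgL : g L = g (-L)) :
    ∫ x in (-L)..L, f x * g' x = -∫ x in (-L)..L, f' x * g x := by
  have := intervalIntegral.integral_mul_deriv_eq_deriv_mul (a := -L) (b := L)
    (fun x _ => hf x) (fun x _ => hg x) (hf'.intervalIntegrable _ _) (hg'.intervalIntegrable _ _)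
  rw [this, hfL, hgL, sub_self, zero_sub]

theorem Function.Periodic.iteratedDeriv_of_periodic {f : ℝ → ℝ} {T : ℝ}
    (hf : Function.Periodic f T) (k : ℕ) : Function.Periodic (iteratedDeriv k f) T := fun x => by
  have h := congrFun (iteratedDeriv_comp_add_const (𝕜 := ℝ) (n := k) (f := f) (s := T)) x
  rw [← h, hf.funext]

theorem Function.Periodic.intervalIntegral_comp_add {f : ℝ → ℝ} {L : ℝ}
    (hf : Function.Periodic f (2 * L)) (b : ℝ) :
    ∫ x in (-L)..L, f (x + b) = ∫ x in (-L)..L, f x := by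
  rw [intervalIntegral.integral_comp_add_right]
  have := hf.intervalIntegral_add_eq (-L + b) (-L)
  rwa [show -L + b + 2 * L = L + b by ring, show -L + 2 * L = L by ring] at this

/-! ### The energy balance -/

theorem IsComparison.energy_le {γ L K : ℝ} {φ φ₁ φ₂ : ℝ → ℝ} (h : IsComparison γ L K φ φ₁ φ₂)
    {v v₁ v₂ v₃ v₄ : ℝ → ℝ} (hv : ∀ x, HasDerivAt v (v₁ x) x) (hv₁ : ∀ x, HasDerivAt v₁ (v₂ x) x)
    (hv₂ : ∀ x, HasDerivAt v₂ (v₃ x) x) (hv₃ : ∀ x, HasDerivAt v₃ (v₄ x) x) (hv₄ : Continuous v₄)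
    (e : v L = v (-L)) (e₁ : v₁ L = v₁ (-L)) (e₂ : v₂ L = v₂ (-L)) (e₃ : v₃ L = v₃ (-L))
    (h0 : (∫ x in (-L)..L, v x) = 0) (horth : (∫ x in (-L)..L, v x * φ₁ x) = 0) :
    ∫ x in (-L)..L, 2 * (v x - φ x) * (-v₄ x - v₂ x + γ * v x + v x * v₁ x)
      ≤ -(∫ x in (-L)..L, (v x - φ x) ^ 2) + K := by
  have c : Continuous v := continuous_iff_continuousAt.2 fun x => (hv x).continuousAt
  have c₁ : Continuous v₁ := continuous_iff_continuousAt.2 fun x => (hv₁ x).continuousAt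
  have c₂ : Continuous v₂ := continuous_iff_continuousAt.2 fun x => (hv₂ x).continuousAt
  have c₃ : Continuous v₃ := continuous_iff_continuousAt.2 fun x => (hv₃ x).continuousAt
  have cφ : Continuous φ := continuous_iff_continuousAt.2 fun x => (h.hasDerivAt x).continuousAt
  have cφ₁ : Continuous φ₁ :=
    continuous_iff_continuousAt.2 fun x => (h.hasDerivAt_one x).continuousAt
  have cφ₂ := h.continuous_two
  refine le_trans (le_of_eq ?_) (h.dissipation v v₁ v₂ hv hv₁ c₂ e e₁ h0 horth)
  have i1 : ∫ x in (-L)..L, v x * v₄ x = ∫ x in (-L)..L, v₂ x ^ 2 := by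
    rw [integral_mul_deriv_eq_neg hv hv₃ c₁ hv₄ e e₃, integral_mul_deriv_eq_neg hv₁ hv₂ c₂ c₃ e₁ e₂,
      neg_neg]
    simp only [sq]
  have i2 : ∫ x in (-L)..L, v x * v₂ x = -∫ x in (-L)..L, v₁ x ^ 2 := by
    rw [integral_mul_deriv_eq_neg hv hv₁ c₁ c₂ e e₁]
    simp only [sq]
  have hv2 : ∀ x, HasDerivAt (fun x => v x ^ 2) (2 * v x * v₁ x) x := fun x =>
    ((hv x).pow 2).congr_deriv (by simp)
  have i3 : ∫ x in (-L)..L, v x ^ 2 * v₁ x = 0 := by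
    have := integral_mul_deriv_eq_neg hv2 hv (by fun_prop) c₁ (by simp only [e]) e
    have h2 : ∫ x in (-L)..L, 2 * v x * v₁ x * v x = 2 * ∫ x in (-L)..L, v x ^ 2 * v₁ x := by
      rw [← intervalIntegral.integral_const_mul]
      congr 1
      ext x
      ring
    linarith
  have i4 : ∫ x in (-L)..L, φ x * v₄ x = ∫ x in (-L)..L, φ₂ x * v₂ x := by
    rw [integral_mul_deriv_eq_neg h.hasDerivAt hv₃ cφ₁ hv₄ h.endpoints e₃,
      integral_mul_deriv_eq_neg h.hasDerivAt_one hv₂ cφ₂ c₃ h.endpoints_one e₂, neg_neg]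
  have i5 : ∫ x in (-L)..L, φ x * v₂ x = ∫ x in (-L)..L, φ₂ x * v x := by
    rw [integral_mul_deriv_eq_neg h.hasDerivAt hv₁ cφ₁ c₂ h.endpoints e₁,
      integral_mul_deriv_eq_neg h.hasDerivAt_one hv cφ₂ c₁ h.endpoints_one e, neg_neg]
  have i6 : ∫ x in (-L)..L, φ x * (2 * v x * v₁ x) = -∫ x in (-L)..L, φ₁ x * v x ^ 2 :=
    integral_mul_deriv_eq_neg h.hasDerivAt hv2 cφ₁ (by fun_prop) h.endpoints (by simp only [e])
  have hexp : ∀ x, 2 * (v x - φ x) * (-v₄ x - v₂ x + γ * v x + v x * v₁ x)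
      = -2 * (v x * v₄ x) + -2 * (v x * v₂ x) + 2 * γ * v x ^ 2 + 2 * (v x ^ 2 * v₁ x)
        + 2 * (φ x * v₄ x) + 2 * (φ x * v₂ x) + -2 * γ * (φ x * v x)
        + -1 * (φ x * (2 * v x * v₁ x)) := fun x => by ring
  simp only [hexp]
  iterate 7 rw [intervalIntegral.integral_add]
  · simp only [intervalIntegral.integral_const_mul, i1, i2, i3, i4, i5]
    have i6' := i6
    simp only [mul_assoc] at i6' ⊢
    simp only [intervalIntegral.integral_const_mul, mul_left_comm (φ _) 2] at i6' ⊢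
    linarith
  all_goals exact Continuous.intervalIntegrable (by fun_prop) _ _

/-! ### Solutions -/

namespace IsKSSolution

variable {γ L : ℝ} {u : ℝ → ℝ → ℝ}

/-- The right-hand side of the equation. -/
noncomputable def rhs (γ : ℝ) (f : ℝ → ℝ) (x : ℝ) : ℝ :=
  -iteratedDeriv 4 f x - iteratedDeriv 2 f x + γ * f x + f x * iteratedDeriv 1 f x

theorem hasDerivAt_time (h : IsKSSolution γ L u) {t : ℝ} (ht : 0 < t) (x : ℝ) :
    HasDerivAt (fun s => u s x) (rhs γ (u t) x) t := by
  have := h.equation t ht x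
  rwa [← iteratedDeriv_one] at this

theorem hasDerivAt_space (h : IsKSSolution γ L u) {t : ℝ} (ht : 0 < t) {k : ℕ} (hk : k < 4)
    (x : ℝ) : HasDerivAt (iteratedDeriv k (u t)) (iteratedDeriv (k + 1) (u t) x) x := by
  rw [iteratedDeriv_succ]
  exact ((h.contDiff t ht).differentiable_iteratedDeriv k (by exact_mod_cast hk) x).hasDerivAt

theorem continuousOn_solution (h : IsKSSolution γ L u) :
    ContinuousOn (fun p : ℝ × ℝ => u p.1 p.2) (Ioi 0 ×ˢ univ) := by
  simpa using h.continuousOn 0 (by norm_num)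

theorem continuousOn_rhs (h : IsKSSolution γ L u) :
    ContinuousOn (fun p : ℝ × ℝ => rhs γ (u p.1) p.2) (Ioi 0 ×ˢ univ) :=
  (((h.continuousOn 4 le_rfl).neg.sub (h.continuousOn 2 (by norm_num))).add
    (h.continuousOn_solution.const_smul γ)).add
      (h.continuousOn_solution.mul (h.continuousOn 1 (by norm_num)))

theorem continuous_space (h : IsKSSolution γ L u) {t : ℝ} (ht : 0 < t) {k : ℕ} (hk : k ≤ 4) :
    Continuous (iteratedDeriv k (u t)) :=
  (h.contDiff t ht).continuous_iteratedDeriv k (by exact_mod_cast hk)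

theorem iteratedDeriv_endpoints (h : IsKSSolution γ L u) {t : ℝ} (ht : 0 < t) (k : ℕ) (b : ℝ) :
    iteratedDeriv k (u t) (L + b) = iteratedDeriv k (u t) (-L + b) := by
  have := (h.periodic t ht.le).iteratedDeriv_of_periodic k (-L + b)
  rwa [show -L + b + 2 * L = L + b by ring] at this

theorem integral_rhs (h : IsKSSolution γ L u) {t : ℝ} (ht : 0 < t) :
    ∫ x in (-L)..L, rhs γ (u t) x = γ * ∫ x in (-L)..L, u t x := by
  have e : ∀ k, iteratedDeriv k (u t) L = iteratedDeriv k (u t) (-L) := fun k => by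
    simpa using h.iteratedDeriv_endpoints ht k 0
  have c0 : Continuous (u t) := by simpa using h.continuous_space ht (k := 0) (by norm_num)
  have c1 := h.continuous_space ht (k := 1) (by norm_num)
  have c2 := h.continuous_space ht (k := 2) (by norm_num)
  have c4 := h.continuous_space ht (k := 4) (by norm_num)
  have d0 : ∀ x, HasDerivAt (u t) (iteratedDeriv 1 (u t) x) x := fun x => by
    simpa using h.hasDerivAt_space ht (k := 0) (by norm_num) x
  have i4 : ∫ x in (-L)..L, iteratedDeriv 4 (u t) x = 0 := by
    rw [intervalIntegral.integral_eq_sub_of_hasDerivAt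
      (fun x _ => h.hasDerivAt_space ht (k := 3) (by norm_num) x) (c4.intervalIntegrable _ _), e,
      sub_self]
  have i2 : ∫ x in (-L)..L, iteratedDeriv 2 (u t) x = 0 := by
    rw [intervalIntegral.integral_eq_sub_of_hasDerivAt
      (fun x _ => h.hasDerivAt_space ht (k := 1) (by norm_num) x) (c2.intervalIntegrable _ _), e,
      sub_self]
  have i1 : ∫ x in (-L)..L, u t x * iteratedDeriv 1 (u t) x = 0 := by
    have e0 : u t L = u t (-L) := by simpa using e 0
    have := integral_mul_deriv_eq_neg d0 d0 c1 c1 e0 e0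
    simp only [mul_comm (iteratedDeriv 1 (u t) _)] at this
    linarith
  unfold rhs
  rw [intervalIntegral.integral_add, intervalIntegral.integral_add, intervalIntegral.integral_sub,
    intervalIntegral.integral_neg, intervalIntegral.integral_const_mul, i1, i2, i4]
  · ring
  all_goals exact Continuous.intervalIntegrable (by fun_prop) _ _

/-- The mean of a solution satisfies `m' = γ m` for positive times, and it is continuous at
time `0`. -/
theorem integral_eq_zero (h : IsKSSolution γ L u) (hL : 0 < L)
    (h0 : (∫ x in (-L)..L, u 0 x) = 0) {t : ℝ} (ht : 0 < t) : ∫ x in (-L)..L, u t x = 0 := by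
  set m : ℝ → ℝ := fun t => ∫ x in (-L)..L, u t x with hm
  have c0 : ∀ t, 0 < t → Continuous (u t) := fun t ht => (h.contDiff t ht).continuous
  have hmd : ∀ t, 0 < t → HasDerivAt m (γ * m t) t := fun t ht => by
    rw [hm, ← h.integral_rhs ht]
    exact hasDerivAt_intervalIntegral_of_continuousOn isOpen_Ioi (F := u)
      (F' := fun t => rhs γ (u t)) (fun t ht => c0 t ht) h.continuousOn_rhs
      (fun t ht x => h.hasDerivAt_time ht x) ht _ _
  have hg : ∀ t, 0 < t → HasDerivAt (fun t => m t * Real.exp (-γ * t)) 0 t := fun t ht => by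
    have he : HasDerivAt (fun t => Real.exp (-γ * t)) (Real.exp (-γ * t) * (-γ * 1)) t :=
      ((hasDerivAt_id t).const_mul (-γ)).exp
    exact ((hmd t ht).mul he).congr_deriv (by ring)
  have hconst : ∀ s, 0 < s → m s * Real.exp (-γ * s) = m t * Real.exp (-γ * t) := fun s hs =>
    isOpen_Ioi.is_const_of_deriv_eq_zero isPreconnected_Ioi
      (fun x hx => (hg x hx).differentiableAt.differentiableWithinAt)
      (fun x hx => (hg x hx).deriv) (mem_Ioi.2 hs) (mem_Ioi.2 ht)
  have hmem : ∀ s, 0 < s → MemLp (u s) 2 (volume.restrict (Icc (-L) L)) := fun s hs =>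
    (memLp_two_iff_integrable_sq (c0 s hs).aestronglyMeasurable).2
      ((c0 s hs).pow 2).continuousOn.integrableOn_Icc
  have hm0 : Tendsto m (𝓝[>] 0) (𝓝 0) := by
    have hset : ∀ s, m s = ∫ x in Icc (-L) L, u s x := fun s => by
      rw [integral_Icc_eq_integral_Ioc]
      exact intervalIntegral.integral_of_le (by linarith)
    have h0' : ∫ x in Icc (-L) L, u 0 x = 0 := by rw [← hset]; exact h0
    suffices hs : Tendsto (fun s => ∫ x in Icc (-L) L, u s x) (𝓝[>] 0)
        (𝓝 (∫ x in Icc (-L) L, u 0 x)) by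
      rw [h0'] at hs
      exact hs.congr fun s => (hset s).symm
    refine tendsto_integral_of_L1' (u 0) h.memLp_initial.aestronglyMeasurable ?_ ?_
    · filter_upwards [self_mem_nhdsWithin] with s hs
      exact (hmem s hs).integrable (by norm_num)
    · have hlim : Tendsto (fun s => l2Norm L (u s - u 0)
          * volume.restrict (Icc (-L) L) univ ^ (1 / (1 : ℝ≥0∞).toReal - 1 / (2 : ℝ≥0∞).toReal))
          (𝓝[>] 0) (𝓝 0) := by
        have := ENNReal.Tendsto.mul_const h.tendsto_initial (b := volume.restrict (Icc (-L) L) univ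
          ^ (1 / (1 : ℝ≥0∞).toReal - 1 / (2 : ℝ≥0∞).toReal)) (Or.inr (by
            refine ENNReal.rpow_ne_top_of_nonneg (by norm_num) ?_
            simp))
        rwa [zero_mul] at this
      refine tendsto_of_tendsto_of_tendsto_of_le_of_le' tendsto_const_nhds hlim
        (Eventually.of_forall fun _ => zero_le) ?_
      filter_upwards [self_mem_nhdsWithin] with s hs
      exact eLpNorm_le_eLpNorm_mul_rpow_measure_univ (by norm_num)
        ((hmem s hs).sub h.memLp_initial).aestronglyMeasurable
  have hlim : Tendsto (fun s => m s * Real.exp (-γ * s)) (𝓝[>] 0) (𝓝 (0 * Real.exp (-γ * 0))) :=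
    hm0.mul ((by fun_prop : Continuous fun s : ℝ => Real.exp (-γ * s)).tendsto 0 |>.mono_left
      nhdsWithin_le_nhds)
  have hlim2 : Tendsto (fun s => m s * Real.exp (-γ * s)) (𝓝[>] 0)
      (𝓝 (m t * Real.exp (-γ * t))) := by
    refine tendsto_const_nhds.congr' ?_
    filter_upwards [self_mem_nhdsWithin] with s hs
    exact (hconst s hs).symm
  have := tendsto_nhds_unique hlim2 hlim
  rw [zero_mul] at this
  exact (mul_eq_zero.1 this).resolve_right (Real.exp_pos _).ne'

end IsKSSolution

/-! ### The distance to the translates of the comparison function -/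

/-- The square of the distance in `L²[-L, L]` between the translate by `b` of `f` and `φ`. -/
noncomputable def translateDist (L : ℝ) (φ f : ℝ → ℝ) (b : ℝ) : ℝ :=
  ∫ y in (-L)..L, (f (y + b) - φ y) ^ 2

/-- The minimum over all translates of the squared distance between a `2 L`-periodic `f` and `φ`. -/
noncomputable def minTranslateDist (L : ℝ) (φ f : ℝ → ℝ) : ℝ :=
  sInf (translateDist L φ f '' Icc (-L) L)

theorem translateDist_nonneg {L : ℝ} (hL : 0 < L) (φ f : ℝ → ℝ) (b : ℝ) :
    0 ≤ translateDist L φ f b :=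
  intervalIntegral.integral_nonneg (by linarith) fun _ _ => sq_nonneg _

theorem minTranslateDist_le {L : ℝ} (hL : 0 < L) {φ f : ℝ → ℝ}
    (hf : Function.Periodic f (2 * L)) (b : ℝ) :
    minTranslateDist L φ f ≤ translateDist L φ f b := by
  have hp : Function.Periodic (translateDist L φ f) (2 * L) := fun b => by
    unfold translateDist
    congr 1
    ext y
    rw [← add_assoc, hf]
  obtain ⟨b', hb', h⟩ := hp.exists_mem_Ico (by linarith) b (-L)
  rw [h]
  refine csInf_le ⟨0, ?_⟩ (mem_image_of_mem _ ⟨hb'.1, by linarith [hb'.2]⟩)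
  rintro _ ⟨c, _, rfl⟩
  exact translateDist_nonneg hL φ f c

theorem exists_minTranslateDist_eq {L : ℝ} (hL : 0 < L) {φ f : ℝ → ℝ} (hφ : Continuous φ)
    (hf : Continuous f) : ∃ b, minTranslateDist L φ f = translateDist L φ f b := by
  have hc : Continuous (translateDist L φ f) :=
    intervalIntegral.continuous_parametric_intervalIntegral_of_continuous'
      (f := fun b y => (f (y + b) - φ y) ^ 2) (by unfold Function.uncurry; fun_prop) _ _
  obtain ⟨b, -, hb⟩ := isCompact_Icc.exists_sInf_image_eq
    (nonempty_Icc.2 (show -L ≤ L by linarith)) hc.continuousOn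
  exact ⟨b, hb⟩

/-- The first-order condition for an optimal translate. -/
theorem integral_mul_eq_zero_of_forall_le {L : ℝ} {φ φ₁ f f₁ : ℝ → ℝ}
    (hφ : ∀ x, HasDerivAt φ (φ₁ x) x) (hφ₁ : Continuous φ₁) (hφL : φ L = φ (-L))
    (hf : ∀ x, HasDerivAt f (f₁ x) x) (hf₁ : Continuous f₁) (hp : Function.Periodic f (2 * L))
    {b : ℝ} (hb : ∀ b', translateDist L φ f b ≤ translateDist L φ f b') :
    ∫ x in (-L)..L, f (x + b) * φ₁ x = 0 := by
  have cf : Continuous f := continuous_iff_continuousAt.2 fun x => (hf x).continuousAt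
  have cφ : Continuous φ := continuous_iff_continuousAt.2 fun x => (hφ x).continuousAt
  have hfb : ∀ x, HasDerivAt (fun x => f (x + b)) (f₁ (x + b)) x := fun x =>
    (hf (x + b)).comp_add_const x b
  have hfe : f (L + b) = f (-L + b) := by
    have := hp (-L + b)
    rwa [show -L + b + 2 * L = L + b by ring] at this
  have hd : HasDerivAt (translateDist L φ f)
      (∫ y in (-L)..L, 2 * (f (y + b) - φ y) * f₁ (y + b)) b := by
    refine hasDerivAt_intervalIntegral_of_continuousOn isOpen_univ
      (F := fun b y => (f (y + b) - φ y) ^ 2)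
      (F' := fun b y => 2 * (f (y + b) - φ y) * f₁ (y + b)) (fun t _ => by fun_prop)
      (Continuous.continuousOn (by unfold Function.uncurry; fun_prop)) (fun t _ x => ?_)
      (mem_univ b) _ _
    exact ((((hf (x + t)).comp_const_add x t).sub_const (φ x)).pow 2).congr_deriv (by simp)
  have h0 := IsLocalMin.hasDerivAt_eq_zero (Eventually.of_forall hb) hd
  have h1 := integral_mul_deriv_eq_neg hfb hfb (by fun_prop) (by fun_prop) hfe hfe
  have h2 := integral_mul_deriv_eq_neg hφ hfb hφ₁ (by fun_prop) hφL hfe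
  have h3 : ∀ y, 2 * (f (y + b) - φ y) * f₁ (y + b)
      = 2 * (f (y + b) * f₁ (y + b)) - 2 * (φ y * f₁ (y + b)) := fun y => by ring
  simp only [h3] at h0
  rw [intervalIntegral.integral_sub, intervalIntegral.integral_const_mul,
    intervalIntegral.integral_const_mul] at h0
  · simp only [mul_comm (f₁ _)] at h1
    simp only [mul_comm (φ₁ _)] at h2
    linarith
  all_goals exact Continuous.intervalIntegrable (by fun_prop) _ _

namespace IsKSSolution

variable {γ L K : ℝ} {u : ℝ → ℝ → ℝ} {φ φ₁ φ₂ : ℝ → ℝ}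

theorem hasDerivAt_translateDist (h : IsKSSolution γ L u) (hφ : Continuous φ) {t : ℝ} (ht : 0 < t)
    (b : ℝ) : HasDerivAt (fun s => translateDist L φ (u s) b)
      (∫ y in (-L)..L, 2 * (u t (y + b) - φ y) * rhs γ (u t) (y + b)) t := by
  have hshift : MapsTo (fun p : ℝ × ℝ => (p.1, p.2 + b)) (Ioi 0 ×ˢ univ) (Ioi 0 ×ˢ univ) :=
    fun p hp => ⟨hp.1, mem_univ _⟩
  have hu := h.continuousOn_solution.comp (f := fun p : ℝ × ℝ => (p.1, p.2 + b)) (by fun_prop)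
    hshift
  have hr := h.continuousOn_rhs.comp (f := fun p : ℝ × ℝ => (p.1, p.2 + b)) (by fun_prop) hshift
  refine hasDerivAt_intervalIntegral_of_continuousOn isOpen_Ioi
    (F := fun s y => (u s (y + b) - φ y) ^ 2)
    (F' := fun s y => 2 * (u s (y + b) - φ y) * rhs γ (u s) (y + b)) (fun s hs => ?_)
    ?_ (fun s hs x => ?_) ht _ _
  · have := (h.contDiff s hs).continuous
    fun_prop
  · exact (continuousOn_const.mul (hu.sub (hφ.comp continuous_snd).continuousOn)).mul hr
  · exact (((h.hasDerivAt_time hs (x + b)).sub_const (φ x)).pow 2).congr_deriv (by simp)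

/-- At an optimal translate the squared distance is dissipated. -/
theorem deriv_translateDist_le (h : IsKSSolution γ L u) (hL : 0 < L)
    (h0 : (∫ x in (-L)..L, u 0 x) = 0) (hφ : IsComparison γ L K φ φ₁ φ₂) {t : ℝ} (ht : 0 < t)
    {b : ℝ} (hb : ∀ b', translateDist L φ (u t) b ≤ translateDist L φ (u t) b') :
    ∫ y in (-L)..L, 2 * (u t (y + b) - φ y) * rhs γ (u t) (y + b)
      ≤ -translateDist L φ (u t) b + K := by
  have cφ₁ : Continuous φ₁ :=
    continuous_iff_continuousAt.2 fun x => (hφ.hasDerivAt_one x).continuousAt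
  have hk := fun k (hk : k < 4) x => (h.hasDerivAt_space ht hk (x + b)).comp_add_const x b
  have he := fun k => h.iteratedDeriv_endpoints ht k b
  have hk0 : ∀ x, HasDerivAt (u t) (iteratedDeriv 1 (u t) x) x := fun x => by
    simpa using h.hasDerivAt_space ht (k := 0) (by norm_num) x
  refine hφ.energy_le (v := fun y => u t (y + b)) (v₁ := fun y => iteratedDeriv 1 (u t) (y + b))
    (v₂ := fun y => iteratedDeriv 2 (u t) (y + b)) (v₃ := fun y => iteratedDeriv 3 (u t) (y + b))
    (v₄ := fun y => iteratedDeriv 4 (u t) (y + b)) (fun x => (hk0 (x + b)).comp_add_const x b)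
    (hk 1 (by norm_num)) (hk 2 (by norm_num)) (hk 3 (by norm_num))
    ((h.continuous_space ht le_rfl).comp (by fun_prop)) (by simpa using he 0) (he 1) (he 2) (he 3)
    ?_ ?_
  · rw [(h.periodic t ht.le).intervalIntegral_comp_add]
    exact h.integral_eq_zero hL h0 ht
  · exact integral_mul_eq_zero_of_forall_le hφ.hasDerivAt cφ₁ hφ.endpoints hk0
      (h.continuous_space ht (by norm_num)) (h.periodic t ht.le) hb

theorem continuousOn_minTranslateDist (h : IsKSSolution γ L u) (hφ : Continuous φ) :
    ContinuousOn (fun t => minTranslateDist L φ (u t)) (Ici 1) := by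
  -- The solution is frozen before time `1`, where joint continuity up to time `0` may fail.
  have hu : Continuous fun p : ℝ × ℝ => u (max p.1 1) p.2 := by
    rw [← continuousOn_univ]
    exact h.continuousOn_solution.comp (f := fun p : ℝ × ℝ => (max p.1 1, p.2)) (by fun_prop)
      fun p _ => ⟨mem_Ioi.2 (lt_max_of_lt_right one_pos), mem_univ _⟩
  have hG : Continuous fun p : ℝ × ℝ => translateDist L φ (u (max p.1 1)) p.2 := by
    refine intervalIntegral.continuous_parametric_intervalIntegral_of_continuous'
      (f := fun (p : ℝ × ℝ) y => (u (max p.1 1) (y + p.2) - φ y) ^ 2) ?_ _ _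
    have := hu.comp (f := fun q : (ℝ × ℝ) × ℝ => (q.1.1, q.2 + q.1.2)) (by fun_prop)
    exact (this.sub (hφ.comp continuous_snd)).pow 2
  have := (isCompact_Icc (a := -L) (b := L)).continuous_sInf
    (f := fun t b => translateDist L φ (u (max t 1)) b) hG
  refine this.continuousOn.congr fun t ht => ?_
  simp only [minTranslateDist, max_eq_left (mem_Ici.1 ht)]

/-- The minimal distance inherits the differential inequality: to the right of a time `t`, it is
bounded by the distance to the translate that is optimal at time `t`. -/
theorem minTranslateDist_le_gronwallBound (h : IsKSSolution γ L u) (hL : 0 < L)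
    (h0 : (∫ x in (-L)..L, u 0 x) = 0) (hφ : IsComparison γ L K φ φ₁ φ₂) {t : ℝ} (ht : 1 ≤ t) :
    minTranslateDist L φ (u t)
      ≤ gronwallBound (minTranslateDist L φ (u 1)) (-1) K (t - 1) := by
  have cφ : Continuous φ := continuous_iff_continuousAt.2 fun x => (hφ.hasDerivAt x).continuousAt
  refine le_gronwallBound_of_liminf_deriv_right_le (a := 1) (b := t)
    (f := fun t => minTranslateDist L φ (u t)) (f' := fun t => -minTranslateDist L φ (u t) + K)
    ((h.continuousOn_minTranslateDist cφ).mono Icc_subset_Ici_self) (fun s hs r hr => ?_) le_rfl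
    (fun s _ => by linarith) t ⟨ht, le_rfl⟩
  have hs0 : 0 < s := one_pos.trans_le hs.1
  obtain ⟨b, hb⟩ := exists_minTranslateDist_eq hL cφ (h.contDiff s hs0).continuous
  have hmin : ∀ b', translateDist L φ (u s) b ≤ translateDist L φ (u s) b' := fun b' =>
    hb ▸ minTranslateDist_le hL (h.periodic s hs0.le) b'
  have hlt := (h.deriv_translateDist_le hL h0 hφ hs0 hmin).trans_lt (hb ▸ hr)
  have hslope := (hasDerivAt_iff_tendsto_slope.1 (h.hasDerivAt_translateDist cφ hs0 b)).mono_left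
    (nhdsWithin_mono s fun z (hz : s < z) => hz.ne')
  refine Eventually.frequently ?_
  filter_upwards [hslope.eventually (gt_mem_nhds hlt), self_mem_nhdsWithin] with z hz hsz
  have hsz : s < z := hsz
  refine lt_of_le_of_lt ?_ hz
  rw [slope_def_module, smul_eq_mul]
  refine mul_le_mul_of_nonneg_left ?_ (inv_nonneg.2 (sub_nonneg.2 hsz.le))
  rw [hb]
  exact sub_le_sub_right (minTranslateDist_le hL (h.periodic z (hs0.trans hsz).le) b) _

theorem integral_sq_le_minTranslateDist (h : IsKSSolution γ L u) (hL : 0 < L) (hφ : Continuous φ)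
    {t : ℝ} (ht : 0 < t) : ∫ x in (-L)..L, u t x ^ 2
      ≤ 2 * minTranslateDist L φ (u t) + 2 * ∫ x in (-L)..L, φ x ^ 2 := by
  have hc := (h.contDiff t ht).continuous
  obtain ⟨b, hb⟩ := exists_minTranslateDist_eq hL hφ hc
  have hp : Function.Periodic (fun x => u t x ^ 2) (2 * L) := fun x => by
    simp only [h.periodic t ht.le x]
  rw [← hp.intervalIntegral_comp_add b, hb, translateDist, ← intervalIntegral.integral_const_mul,
    ← intervalIntegral.integral_const_mul, ← intervalIntegral.integral_add]
  · refine intervalIntegral.integral_mono (by linarith) ?_ ?_ fun x => ?_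
    · exact Continuous.intervalIntegrable (by fun_prop) _ _
    · exact Continuous.intervalIntegrable (by fun_prop) _ _
    · nlinarith [sq_nonneg (u t (x + b) - 2 * φ x)]
  all_goals exact Continuous.intervalIntegrable (by fun_prop) _ _

end IsKSSolution

/-! ### The absorbing ball -/

theorem l2Norm_eq_ofReal_sqrt {L : ℝ} (hL : 0 < L) {f : ℝ → ℝ} (hf : Continuous f) :
    l2Norm L f = ENNReal.ofReal √(∫ x in (-L)..L, f x ^ 2) := by
  have hmem : MemLp f 2 (volume.restrict (Icc (-L) L)) :=
    (memLp_two_iff_integrable_sq hf.aestronglyMeasurable).2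
      (hf.pow 2).continuousOn.integrableOn_Icc
  rw [l2Norm, hmem.eLpNorm_eq_integral_rpow_norm two_ne_zero ENNReal.ofNat_ne_top,
    intervalIntegral.integral_of_le (by linarith), ← integral_Icc_eq_integral_Ioc, Real.sqrt_eq_rpow]
  simp

theorem mainTheorem2 (γ : ℝ) (hγ : 0 ≤ γ) :
    ∃ C : ℝ, 0 < C ∧ ∀ L : ℝ, 0 < L → ∀ u : ℝ → ℝ → ℝ,
      IsKSSolution γ L u → (∫ x in (-L)..L, u 0 x) = 0 →
        limsup (fun t => l2Norm L (u t)) atTop ≤ ENNReal.ofReal (C * L ^ (3 / 2 : ℝ)) ∧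
        ∀ᶠ t in atTop, l2Norm L (u t) ≤ ENNReal.ofReal (C * L ^ (3 / 2 : ℝ)) := by
  obtain ⟨C, hC, H⟩ := exists_isComparison hγ
  refine ⟨√(2 * (C + 1)), by positivity, fun L hL u hu h0 => ?_⟩
  obtain ⟨K, φ, φ₁, φ₂, hφ, hK⟩ := H L hL
  have cφ : Continuous φ := continuous_iff_continuousAt.2 fun x => (hφ.hasDerivAt x).continuousAt
  have hev : ∀ᶠ t in atTop, l2Norm L (u t) ≤ ENNReal.ofReal (√(2 * (C + 1)) * L ^ (3 / 2 : ℝ)) := by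
    have hlim : Tendsto (fun t => gronwallBound (minTranslateDist L φ (u 1)) (-1) K (t - 1)) atTop
        (𝓝 K) := by
      rw [gronwallBound_of_K_ne_0 (by norm_num)]
      have he : Tendsto (fun t : ℝ => Real.exp (-1 * (t - 1))) atTop (𝓝 0) := by
        refine Real.tendsto_exp_atBot.comp ?_
        simp only [neg_one_mul]
        exact tendsto_neg_atTop_atBot.comp (tendsto_atTop_add_const_right _ _ tendsto_id)
      have := (he.const_mul (minTranslateDist L φ (u 1))).add ((he.sub_const 1).const_mul (K / -1))
      convert this using 2
      ring
    filter_upwards [hlim.eventually (gt_mem_nhds (show K < K + L ^ 3 by linarith [pow_pos hL 3])),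
      eventually_ge_atTop 1] with t ht ht1
    have ht0 : 0 < t := one_pos.trans_le ht1
    rw [l2Norm_eq_ofReal_sqrt hL (hu.contDiff t ht0).continuous]
    refine ENNReal.ofReal_le_ofReal ?_
    have hL3 : L ^ (3 / 2 : ℝ) = √(L ^ 3) := by
      rw [Real.sqrt_eq_rpow, ← Real.rpow_natCast, ← Real.rpow_mul hL.le]
      norm_num
    rw [hL3, ← Real.sqrt_mul (by positivity)]
    refine Real.sqrt_le_sqrt ?_
    have h1 := hu.integral_sq_le_minTranslateDist hL cφ ht0
    have h2 := hu.minTranslateDist_le_gronwallBound hL h0 hφ ht1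
    linarith
  exact ⟨limsup_le_of_le (by isBoundedDefault) hev, hev⟩
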